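/- Let $\lambda$ be an infinite cardinal and $k\ge 2$ an integer. Put $S=[\lambda]^{<\aleph_0}$, let $\mathfrak D$ be the filter on $S$ generated by the sets $\{v\in S : u\subseteq v\}$ ($u\in S$), and let $G$ be the group of all $g:S\to\mathbb Z_2$ with $\{s : g(s)=0\}\in\mathfrak D$. For a set $I$ let $H_I=[{}^kI]^{<\aleph_0}$ be the group of finite subsets of ${}^kI$ under symmetric difference; $h\in H_I$ is also read as a characteristic function ${}^kI\to\mathbb Z_2$. For $f:{}^{k+1}I\times S\to\mathbb Z_2$ let $M_{I,f}$ be the following structure. Its universe is the disjoint union of $I$, ${}^kI$, ${}^{k+1}I$, ${}^kI\times S\times H_I$, ${}^kI\times S\times\mathbb Z_2$, $H_I$ and ${}^{k+1}I\times G$. Its vocabulary $\tau$ consists of unary predicates $P_0,P_{1,1},P_{1,2},P_2,P_3,P_4,P_5$ for these pieces ($P_2$ being ${}^kI\times S\times H_I$, $P_3$ being ${}^kI\times S\times \mathbb Z_2$, $P_4=H_I$, $P_5={}^{k+1}I\times G$); for $s\in S$, unary predicates $P_{2,s}={}^kI\times\{s\}\times H_I$ and $P_{3,s}={}^kI\times\{s\}\times\mathbb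 Z_2$; the coordinate projections $\pi_\ell$ ($\ell\le k$) from ${}^kI$ (for $\ell<k$) and ${}^{k+1}I$ to $I$; partial functions $F_2(u,s,h)=u$, $F_3(u,s,i)=u$, $F_5(u,g)=u$, $F_4((u,s,h),h_1)=(u,s,h+h_1)$, and $F_{3,g^*}(u,g)=(u,g^*+g)$ for $g^*\in G$ (partial functions being treated as relations through their graphs); and, for $s\in S$, the relation $Q_s$ consisting of all tuples $$\langle a_0,\dots,a_k,\,u_0,\dots,u_k,\,x_0,\dots,x_{k-1},\,y_k,\,z\rangle$$ such that the $a_\ell\in I$ are pairwise distinct, $u_\ell=\langle a_m : m\ne\ell\rangle$, $x_\ell=(u_\ell,s,i_\ell)$ for $\ell<k$, $y_k=(u_k,s,h_k)$, $z=(u,g)$ with $u=\langle a_0,\dots,a_k\rangle$, and $$\sum_{\ell<k} i_\ell=h_k(u_0)+g(s)+f(u,s)\quad\text{in }\mathbb Z_2 .$$ Let $M_I=M_{I,0}$. A function $f:[I]^{k+1}\times S\to\mathbb Z_2$ is regarded as a function on ${}^{k+1}I\times S$ via $f(u,s)=f(\{a_0,\dots,a_k\},s)$ for tuples $u$ without repetition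 (the other tuples play no role in $M_{I,f}$). Such an $f$ is called an $I$-function if $\{s\in S : f_w\neq 0\}\in\mathfrak D$ for every $w\in[I]^{k+1}$, where $f_w:S\to\mathbb Z_2$ is the function $f_w(s)=f(w,s)$; that is, no $f_w$ is the zero function. Let $T_0$ be the set of all first-order $\tau$-sentences that hold in $M_I$ for every infinite set $I$, and let $\psi\in\mathcal L_{(2^\lambda)^+,\omega}(\tau)$ be the conjunction of $\bigwedge T_0$ and the three sentences $$\forall z_1z_2\Big(P_5(z_1)\wedge P_5(z_2)\wedge F_5(z_1)=F_5(z_2)\to\bigvee_{g^*\in G}F_{3,g^*}(z_1)=z_2\Big),$$ $$\forall y\Big(P_2(y)\leftrightarrow\bigvee_{s\in S}P_{2,s}(y)\Big),\qquad \forall y\Big(P_3(y)\leftrightarrow\bigvee_{s\in S}P_{3,s}(y)\Big).$$ Then for $\mu=\beth_{k+1}(\lambda)^+$ (where $\beth_0(\lambda)=\lambda$ and $\beth_{n+1}(\lambda)=2^{\beth_n(\lambda)}$) the sentence $\psi$ is not categorical in $\mu$: it has two non-isomorphic models of cardinality $\mu$. More precisely, for every set $I$ with $|I|=\mu$ there is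 an $I$-function $f:[I]^{k+1}\times S\to\mathbb Z_2$ such that $M_I$ and $M_{I,f}$ are models of $\psi$ of cardinality $\mu$ and $M_{I,f}\not\cong M_I$. -/

import Mathlib

open FirstOrder Cardinal

universe u

/-! ## Infinitary logic -/

/-- Formulas of `L_{κ,ω}`, over the vocabulary `L`, with free variables indexed by `α ⊕ Fin n`
(the same conventions on variables as for Mathlib's first-order `BoundedFormula`).
Conjunctions and disjunctions of families of fewer than `κ` formulas are allowed,
and quantification over one variable at a time. -/
inductive InfFormula (L : FirstOrder.Language.{u, u}) (κ : Cardinal.{u}) (α : Type) : ℕ → Type (u + 1)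
  | falsum {n : ℕ} : InfFormula L κ α n
  | equal {n : ℕ} (t₁ t₂ : L.Term (α ⊕ Fin n)) : InfFormula L κ α n
  | rel {n l : ℕ} (R : L.Relations l) (ts : Fin l → L.Term (α ⊕ Fin n)) : InfFormula L κ α n
  | imp {n : ℕ} (φ θ : InfFormula L κ α n) : InfFormula L κ α n
  | and {n : ℕ} (φ θ : InfFormula L κ α n) : InfFormula L κ α n
  | all {n : ℕ} (φ : InfFormula L κ α (n + 1)) : InfFormula L κ α n
  | ex {n : ℕ} (φ : InfFormula L κ α (n + 1)) : InfFormula L κ α n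
  | iConj {n : ℕ} {ι : Type u} (hι : #ι < κ) (φ : ι → InfFormula L κ α n) : InfFormula L κ α n
  | iDisj {n : ℕ} {ι : Type u} (hι : #ι < κ) (φ : ι → InfFormula L κ α n) : InfFormula L κ α n

namespace InfFormula

variable {L : FirstOrder.Language.{u, u}} {κ : Cardinal.{u}} {α : Type}

/-- Satisfaction of a formula of `L_{κ,ω}` in a structure. -/
def Realize {M : Type u} [L.Structure M] (v : α → M) :
    {n : ℕ} → InfFormula L κ α n → (Fin n → M) → Prop
  | _, falsum, _ => False
  | _, equal t₁ t₂, xs => t₁.realize (Sum.elim v xs) = t₂.realize (Sum.elim v xs)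
  | _, rel R ts, xs => FirstOrder.Language.Structure.RelMap R fun i => (ts i).realize (Sum.elim v xs)
  | _, imp φ θ, xs => φ.Realize v xs → θ.Realize v xs
  | _, and φ θ, xs => φ.Realize v xs ∧ θ.Realize v xs
  | _, all φ, xs => ∀ x : M, φ.Realize v (Fin.snoc xs x)
  | _, ex φ, xs => ∃ x : M, φ.Realize v (Fin.snoc xs x)
  | _, iConj _ φ, xs => ∀ i, (φ i).Realize v xs
  | _, iDisj _ φ, xs => ∃ i, (φ i).Realize v xs

/-- Every first-order formula is a formula of `L_{κ,ω}`. -/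
def ofFirstOrder : {n : ℕ} → L.BoundedFormula α n → InfFormula L κ α n
  | _, .falsum => falsum
  | _, .equal t₁ t₂ => equal t₁ t₂
  | _, .rel R ts => rel R ts
  | _, .imp φ θ => imp (ofFirstOrder φ) (ofFirstOrder θ)
  | _, .all φ => all (ofFirstOrder φ)

theorem realize_ofFirstOrder {M : Type u} [L.Structure M] {v : α → M} {n : ℕ}
    (φ : L.BoundedFormula α n) (xs : Fin n → M) :
    (ofFirstOrder φ : InfFormula L κ α n).Realize v xs ↔ φ.Realize v xs := by
  induction φ with
  | falsum => exact Iff.rfl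
  | equal t₁ t₂ => exact Iff.rfl
  | rel R ts => exact Iff.rfl
  | imp φ θ ih₁ ih₂ => exact imp_congr (ih₁ xs) (ih₂ xs)
  | all φ ih => exact forall_congr' fun x => ih _

/-- The biconditional. -/
def iff {n : ℕ} (φ θ : InfFormula L κ α n) : InfFormula L κ α n := and (imp φ θ) (imp θ φ)

end InfFormula

/-- Sentences of `L_{κ,ω}`. -/
abbrev InfSentence (L : FirstOrder.Language.{u, u}) (κ : Cardinal.{u}) : Type (u + 1) :=
  InfFormula L κ Empty 0

namespace InfSentence

variable {L : FirstOrder.Language.{u, u}} {κ : Cardinal.{u}}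

/-- `σ.Holds M` : the structure `M` is a model of the sentence `σ`. -/
def Holds (σ : InfSentence L κ) (M : Type u) [L.Structure M] : Prop :=
  InfFormula.Realize (Empty.elim : Empty → M) σ Fin.elim0

/-- `σ` is categorical in `μ` : any two models of `σ` of cardinality `μ` are isomorphic. -/
def Categorical (σ : InfSentence L κ) (μ : Cardinal.{u}) : Prop :=
  ∀ (M N : Type u) [L.Structure M] [L.Structure N],
    #M = μ → #N = μ → σ.Holds M → σ.Holds N → Nonempty (M ≃[L] N)

end InfSentence

/-- The iterated power `ℶ_n(κ)`: `ℶ_0(κ) = κ` and `ℶ_{n+1}(κ) = 2 ^ ℶ_n(κ)`. -/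
def bethIter (κ : Cardinal.{u}) : ℕ → Cardinal.{u}
  | 0 => κ
  | n + 1 => 2 ^ bethIter κ n

/-! ## The canonical models

`Λ` is an infinite set of cardinality `λ`, and `S = [λ]^{<ℵ₀}` is `Finset Λ`. -/

namespace Canonical

/-- The regular filter on `S = [λ]^{<ℵ₀}` generated by the sets `⟨u⟩ = {v | u ⊆ v}`. -/
def regFilter (Λ : Type u) : Filter (Finset Λ) := Filter.atTop

theorem mem_regFilter {Λ : Type u} {A : Set (Finset Λ)} :
    A ∈ regFilter Λ ↔ ∃ u : Finset Λ, ∀ v : Finset Λ, u ⊆ v → v ∈ A :=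
  Filter.mem_atTop_sets

/-- The group `G` of the functions `S → ℤ/2` whose kernel lies in the filter. -/
def G (Λ : Type u) : AddSubgroup (Finset Λ → ZMod 2) where
  carrier := {g | {v | g v = 0} ∈ regFilter Λ}
  zero_mem' := Filter.Eventually.of_forall fun _ => rfl
  add_mem' {a b} ha hb := by
    filter_upwards [ha, hb] with v h₁ h₂
    have h₁ : a v = 0 := h₁
    have h₂ : b v = 0 := h₂
    simp [h₁, h₂]
  neg_mem' {a} ha := by
    filter_upwards [ha] with v h
    have h : a v = 0 := h
    simp [h]

/-- The group `H_I` of the finite subsets of `^kI` under symmetric difference, each finite set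
being identified with its characteristic function `^kI → ℤ/2`. -/
abbrev H (k : ℕ) (I : Type u) : Type u := (Fin k → I) →₀ ZMod 2

/-- The symbols of the vocabulary `τ`. A partial function is represented by its graph, so that
a partial function of `n` variables is a relation symbol of arity `n + 1`.
The arguments of `Q s` are, in this order, `a_0, …, a_k`, `u_0, …, u_k`, `x_0, …, x_{k-1}`,
`y_k`, `z`. -/
inductive Sym (Λ : Type u) (k : ℕ) : ℕ → Type u
  | P0 : Sym Λ k 1
  | P11 : Sym Λ k 1
  | P12 : Sym Λ k 1
  | P2 : Sym Λ k 1
  | P2s (s : Finset Λ) : Sym Λ k 1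
  | P3 : Sym Λ k 1
  | P3s (s : Finset Λ) : Sym Λ k 1
  | P4 : Sym Λ k 1
  | P5 : Sym Λ k 1
  | proj (l : Fin (k + 1)) : Sym Λ k 2
  | F2 : Sym Λ k 2
  | F3 : Sym Λ k 2
  | F4 : Sym Λ k 3
  | F5 : Sym Λ k 2
  | F3g (g : G Λ) : Sym Λ k 2
  | Q (s : Finset Λ) : Sym Λ k ((k + 1) + (k + 1) + k + 2)

/-- The vocabulary `τ`. -/
def tau (Λ : Type u) (k : ℕ) : FirstOrder.Language.{u, u} where
  Functions := fun _ => PEmpty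
  Relations := Sym Λ k

/-- The universe of `M_I`: the disjoint union of `I`, `^kI`, `^{k+1}I`, `^kI × S × H`,
`^kI × S × ℤ/2`, `H` and `^{k+1}I × G`. -/
inductive Carrier (Λ : Type u) (k : ℕ) (I : Type u) : Type u
  | pt (a : I)
  | tup (u : Fin k → I)
  | tup' (u : Fin (k + 1) → I)
  | hCopy (u : Fin k → I) (s : Finset Λ) (h : H k I)
  | zCopy (u : Fin k → I) (s : Finset Λ) (i : ZMod 2)
  | hElt (h : H k I)
  | gCopy (u : Fin (k + 1) → I) (g : G Λ)

section Models

variable {Λ : Type u} {k : ℕ} {I : Type u}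

open Carrier

/-- For `a = (a_0, …, a_k)`, the `k`-tuple `u_l` obtained from `a` by omitting `a_l`. -/
def omit_ (a : Fin (k + 1) → I) (l : Fin (k + 1)) : Fin k → I := fun j => a (l.succAbove j)

/-- The interpretation of the symbols of `τ` in `M_{I,f}`. -/
def interp (f : (Fin (k + 1) → I) → Finset Λ → ZMod 2) :
    {n : ℕ} → Sym Λ k n → (Fin n → Carrier Λ k I) → Prop
  | _, .P0, v => ∃ a, v 0 = pt a
  | _, .P11, v => ∃ u, v 0 = tup u
  | _, .P12, v => ∃ u, v 0 = tup' u
  | _, .P2, v => ∃ u s h, v 0 = hCopy u s h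
  | _, .P2s s, v => ∃ u h, v 0 = hCopy u s h
  | _, .P3, v => ∃ u s i, v 0 = zCopy u s i
  | _, .P3s s, v => ∃ u i, v 0 = zCopy u s i
  | _, .P4, v => ∃ h, v 0 = hElt h
  | _, .P5, v => ∃ u g, v 0 = gCopy u g
  | _, .proj l, v =>
      (∃ (u : Fin k → I) (j : Fin k), l = j.castSucc ∧ v 0 = tup u ∧ v 1 = pt (u j)) ∨
      (∃ u : Fin (k + 1) → I, v 0 = tup' u ∧ v 1 = pt (u l))
  | _, .F2, v => ∃ u s h, v 0 = hCopy u s h ∧ v 1 = tup u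
  | _, .F3, v => ∃ u s i, v 0 = zCopy u s i ∧ v 1 = tup u
  | _, .F4, v => ∃ u s h h₁, v 0 = hCopy u s h ∧ v 1 = hElt h₁ ∧ v 2 = hCopy u s (h + h₁)
  | _, .F5, v => ∃ u g, v 0 = gCopy u g ∧ v 1 = tup' u
  | _, .F3g g', v => ∃ u g, v 0 = gCopy u g ∧ v 1 = gCopy u (g' + g)
  | _, .Q s, v =>
      ∃ (a : Fin (k + 1) → I) (i : Fin k → ZMod 2) (h : H k I) (g : G Λ),
        Function.Injective a ∧
        v = Fin.append
          (Fin.append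
            (Fin.append (fun l => pt (a l)) (fun l => tup (omit_ a l)))
            (fun l : Fin k => zCopy (omit_ a l.castSucc) s (i l)))
          ![hCopy (omit_ a (Fin.last k)) s h, gCopy a g] ∧
        ∑ l, i l = h (omit_ a 0) + (g : Finset Λ → ZMod 2) s + f a s

end Models

/-- The model `M_{I,f}`, for `f : ^{k+1}I × S → ℤ/2`. -/
def Model (Λ : Type u) (k : ℕ) (I : Type u) (_f : (Fin (k + 1) → I) → Finset Λ → ZMod 2) :
    Type u :=
  Carrier Λ k I

instance (Λ : Type u) (k : ℕ) (I : Type u) (f : (Fin (k + 1) → I) → Finset Λ → ZMod 2) :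
    (tau Λ k).Structure (Model Λ k I f) where
  funMap := fun F => PEmpty.elim F
  RelMap := fun R v => interp f R v

/-- The model `M_I`, that is `M_{I,f}` for `f = 0`. -/
abbrev Model₀ (Λ : Type u) (k : ℕ) (I : Type u) : Type u := Model Λ k I fun _ _ => 0

/-! ## The sentence `ψ` -/

/-- The set `T_0` of the first-order sentences that hold in `M_I` for every infinite set `I`. -/
def T0 (Λ : Type u) (k : ℕ) : Set (tau Λ k).Sentence :=
  {σ | ∀ I : Type u, Infinite I → Model₀ Λ k I ⊨ σ}

section Cardinality

variable (Λ : Type u) (k : ℕ)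

theorem mk_G_le [Infinite Λ] : #(G Λ) ≤ (2 : Cardinal.{u}) ^ #Λ := by
  refine (Cardinal.mk_subtype_le _).trans ?_
  simp [Cardinal.mk_pi]

theorem mk_S_lt [Infinite Λ] : #(Finset Λ) < Order.succ ((2 : Cardinal.{u}) ^ #Λ) := by
  rw [Cardinal.mk_finset_of_infinite, Order.lt_succ_iff]
  exact (Cardinal.cantor _).le

theorem mk_G_lt [Infinite Λ] : #(G Λ) < Order.succ ((2 : Cardinal.{u}) ^ #Λ) := Order.lt_succ_iff.2 (mk_G_le Λ)

/-- An injective coding of the symbols of `τ`. -/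
def code : (Σ n, Sym Λ k n) → ℕ × Finset Λ × G Λ
  | ⟨_, .P0⟩ => (0, ∅, 0)
  | ⟨_, .P11⟩ => (1, ∅, 0)
  | ⟨_, .P12⟩ => (2, ∅, 0)
  | ⟨_, .P2⟩ => (3, ∅, 0)
  | ⟨_, .P2s s⟩ => (4, s, 0)
  | ⟨_, .P3⟩ => (5, ∅, 0)
  | ⟨_, .P3s s⟩ => (6, s, 0)
  | ⟨_, .P4⟩ => (7, ∅, 0)
  | ⟨_, .P5⟩ => (8, ∅, 0)
  | ⟨_, .F2⟩ => (9, ∅, 0)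
  | ⟨_, .F3⟩ => (10, ∅, 0)
  | ⟨_, .F4⟩ => (11, ∅, 0)
  | ⟨_, .F5⟩ => (12, ∅, 0)
  | ⟨_, .F3g g⟩ => (13, ∅, g)
  | ⟨_, .Q s⟩ => (14, s, 0)
  | ⟨_, .proj l⟩ => (15 + l, ∅, 0)

theorem code_injective : Function.Injective (code Λ k) := by
  rintro ⟨_, a⟩ ⟨_, b⟩ h
  cases a <;> cases b <;> simp [code] at h
  all_goals first
    | rfl
    | omega
    | (subst h; rfl)
    | (have h' := Fin.ext h; subst h'; rfl)

theorem card_tau_le [Infinite Λ] : (tau Λ k).card ≤ (2 : Cardinal.{u}) ^ #Λ := by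
  have h1 : ℵ₀ ≤ (2 : Cardinal.{u}) ^ #Λ := (Cardinal.aleph0_le_mk Λ).trans (Cardinal.cantor _).le
  have h2 : #(Σ n, Sym Λ k n) ≤ (2 : Cardinal.{u}) ^ #Λ := by
    refine (Cardinal.mk_le_of_injective (code_injective Λ k)).trans ?_
    simp only [Cardinal.mk_prod, Cardinal.lift_id, Cardinal.lift_uzero, Cardinal.mk_nat,
      Cardinal.lift_aleph0]
    refine Cardinal.mul_le_of_le h1 h1 (Cardinal.mul_le_of_le h1 ?_ (mk_G_le Λ))
    exact Order.lt_succ_iff.1 (mk_S_lt Λ)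
  have h3 : #(Σ n, (tau Λ k).Functions n) = 0 := by
    rw [Cardinal.mk_eq_zero_iff]
    exact ⟨fun x => PEmpty.elim x.2⟩
  have h4 : (tau Λ k).card = #(Σ n, (tau Λ k).Functions n) + #(Σ n, Sym Λ k n) := by
    simp [FirstOrder.Language.card, FirstOrder.Language.Symbols, tau, Cardinal.mk_sum]
  rw [h4, h3, zero_add]
  exact h2

theorem mk_T0_lt [Infinite Λ] : #(T0 Λ k) < Order.succ ((2 : Cardinal.{u}) ^ #Λ) := by
  rw [Order.lt_succ_iff]
  refine (Cardinal.mk_subtype_le _).trans ?_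
  have h1 : ℵ₀ ≤ (2 : Cardinal.{u}) ^ #Λ := (Cardinal.aleph0_le_mk Λ).trans (Cardinal.cantor _).le
  have hinj : Function.Injective
      (fun σ : (tau Λ k).Sentence => (⟨0, σ⟩ : Σ n, (tau Λ k).BoundedFormula Empty n)) :=
    fun a b h => by simpa using h
  refine (Cardinal.mk_le_of_injective hinj).trans ?_
  refine FirstOrder.Language.BoundedFormula.card_le.trans (max_le h1 ?_)
  simpa using card_tau_le Λ k

end Cardinality

section Sentence

variable (Λ : Type u) [Infinite Λ] (k : ℕ)

/-- The `i`-th bound variable, as a term. -/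
noncomputable def var {n : ℕ} (i : Fin n) : (tau Λ k).Term (Empty ⊕ Fin n) := FirstOrder.Language.Term.var (Sum.inr i)

/-- The atomic formula saying that the symbol `R` holds of the listed bound variables. -/
noncomputable def atom {n l : ℕ} (R : Sym Λ k l) (x : Fin l → Fin n) :
    InfFormula (tau Λ k) (Order.succ ((2 : Cardinal.{u}) ^ #Λ)) Empty n :=
  InfFormula.rel (L := tau Λ k) R fun i => var Λ k (x i)

/-- `⋀ T_0`. -/
noncomputable def psiT0 : InfSentence (tau Λ k) (Order.succ ((2 : Cardinal.{u}) ^ #Λ)) :=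
  InfFormula.iConj (mk_T0_lt Λ k) fun σ => InfFormula.ofFirstOrder σ.1

/-- `∀ z₁ z₂, P_5(z₁) ∧ P_5(z₂) ∧ F_5(z₁) = F_5(z₂) → ⋁_{g ∈ G} F_{3,g}(z₁) = z₂`. -/
noncomputable def psiG : InfSentence (tau Λ k) (Order.succ ((2 : Cardinal.{u}) ^ #Λ)) :=
  .all (.all (.imp
    (.and (atom Λ k .P5 ![0]) (.and (atom Λ k .P5 ![1])
      (.ex (.and (atom Λ k .F5 ![0, 2]) (atom Λ k .F5 ![1, 2])))))
    (.iDisj (mk_G_lt Λ) fun g : G Λ => atom Λ k (.F3g g) ![0, 1])))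

/-- `∀ y, P_2(y) ↔ ⋁_{s ∈ S} P_{2,s}(y)`. -/
noncomputable def psiP2 : InfSentence (tau Λ k) (Order.succ ((2 : Cardinal.{u}) ^ #Λ)) :=
  .all (.iff (atom Λ k .P2 ![0])
    (.iDisj (mk_S_lt Λ) fun s : Finset Λ => atom Λ k (.P2s s) ![0]))

/-- `∀ y, P_3(y) ↔ ⋁_{s ∈ S} P_{3,s}(y)`. -/
noncomputable def psiP3 : InfSentence (tau Λ k) (Order.succ ((2 : Cardinal.{u}) ^ #Λ)) :=
  .all (.iff (atom Λ k .P3 ![0])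
    (.iDisj (mk_S_lt Λ) fun s : Finset Λ => atom Λ k (.P3s s) ![0]))

/-- The sentence `ψ` of `L_{(2^λ)^+, ω}(τ)`. -/
noncomputable def psi : InfSentence (tau Λ k) (Order.succ ((2 : Cardinal.{u}) ^ #Λ)) :=
  .and (psiT0 Λ k) (.and (psiG Λ k) (.and (psiP2 Λ k) (psiP3 Λ k)))

end Sentence

/-! ## Functions on `(k+1)`-element subsets -/

open Classical in
/-- A function `f : [I]^{k+1} × S → ℤ/2`, read as a function on `^{k+1}I × S` through
`(a_0, …, a_k) ↦ {a_0, …, a_k}`. Tuples with repetitions, for which the value plays no role in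
`M_{I,f}`, get the value `0`. -/
noncomputable def onTuples {Λ : Type u} {k : ℕ} {I : Type u}
    (f : {w : Finset I // w.card = k + 1} → Finset Λ → ZMod 2) :
    (Fin (k + 1) → I) → Finset Λ → ZMod 2 :=
  fun a s =>
    if h : Function.Injective a then
      f ⟨Finset.univ.map ⟨a, h⟩, by simp⟩ s
    else 0

/-- `f : [I]^{k+1} × S → ℤ/2` is an `I`-function if `{s ∈ S | f_w ≠ 0}` is in the filter for every
`w`, where `f_w : S → ℤ/2` is the function `s ↦ f(w, s)`. -/
def IsIFunction {Λ : Type u} {k : ℕ} {I : Type u}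
    (f : {w : Finset I // w.card = k + 1} → Finset Λ → ZMod 2) : Prop :=
  ∀ w, {_s : Finset Λ | f w ≠ 0} ∈ regFilter Λ

end Canonical

/-! Both structures are models because a first-order sentence mentions only finitely many `Q s`. A
function on `S` with finite support lies in `G`, so translating the `G`-fibre over each `a` by `f a
- f' a`, cut down to those finitely many `s`, is an isomorphism of the relevant reducts. Hence every
`M_{I,f}` satisfies `T0` (`realize_sentence_iff`), and the three infinitary clauses do not see `f`
(`holds_psi`).

For non-isomorphism, an isomorphism onto `M_I` yields a functional equation
(`exists_functional_equation`): up to terms `c` in the first `k` faces of `a`, `f a s` equals a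
value of a finitely supported function attached to the last face plus an element `e a` of `G`. Fix
distinct points `b_0, …, b_k`. Finite support excludes at most `λ` points `z`, so some `z` kills the
`d`-terms for all tuples `a_j = (b` without `b_j, z)` and all `s` at once. Summed over `j`, the
`c`-terms cancel since each face occurs twice (`sum_sum_omit_omit`), so `∑ f(a_j, s) = ∑ e(a_j)(s)`,
which is `0` for large `s`. The chosen `f` makes the left side `1` for every `s ≠ ∅`. -/

namespace Canonical

open Carrier

/-! ### Elementary equivalence of the `M_{I,f}` by fibrewise translations. -/

section ElementaryEquivalence

variable {Λ : Type u} {k : ℕ} {I : Type u}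

/-- Translation of the `G`-coordinate over each `(k+1)`-tuple `a` by `r a`. -/
def shift (r : (Fin (k + 1) → I) → G Λ) : Carrier Λ k I → Carrier Λ k I
  | gCopy a g => gCopy a (g + r a)
  | x => x

theorem G_add_self (g : G Λ) : g + g = 0 := by
  ext s
  exact CharTwo.add_self_eq_zero _

theorem shift_shift (r : (Fin (k + 1) → I) → G Λ) (x : Carrier Λ k I) :
    shift r (shift r x) = x := by
  cases x <;> simp [shift, add_assoc, G_add_self]

/-- `shift` as a permutation of the universe. -/
def shiftEquiv (r : (Fin (k + 1) → I) → G Λ) : Carrier Λ k I ≃ Carrier Λ k I where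
  toFun := shift r
  invFun := shift r
  left_inv := shift_shift r
  right_inv := shift_shift r

/-- Every symbol belongs to the reduct determined by `A ⊆ S`, except the `Q s` with `s ∉ A`. -/
def InReduct (A : Finset (Finset Λ)) : {n : ℕ} → Sym Λ k n → Prop
  | _, .Q s => s ∈ A
  | _, _ => True

theorem exists_inReduct {n : ℕ} (R : Sym Λ k n) : ∃ A : Finset (Finset Λ), InReduct A R := by
  cases R
  case Q s => exact ⟨{s}, Finset.mem_singleton_self s⟩
  all_goals exact ⟨∅, trivial⟩

theorem append_shift {m n : ℕ} (r : (Fin (k + 1) → I) → G Λ) (v : Fin m → Carrier Λ k I)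
    (w : Fin n → Carrier Λ k I) :
    (fun i => shift r (Fin.append v w i)) =
      Fin.append (fun i => shift r (v i)) (fun i => shift r (w i)) := by
  funext i
  refine Fin.addCases (fun j => ?_) (fun j => ?_) i <;> simp

/-- Among the symbols, only `Q s` compares the `G`-coordinate with `f`, and there the shift absorbs
the difference of `f` and `f'`. The maps `F3g` commute with the shift because they translate on the
other side. -/
theorem interp_shift {A : Finset (Finset Λ)} {f f' : (Fin (k + 1) → I) → Finset Λ → ZMod 2}
    {r : (Fin (k + 1) → I) → G Λ}
    (hr : ∀ a, ∀ s ∈ A, f a s = (r a : Finset Λ → ZMod 2) s + f' a s)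
    {n : ℕ} {R : Sym Λ k n} (hR : InReduct A R) {v : Fin n → Carrier Λ k I}
    (h : interp f R v) : interp f' R (fun i => shift r (v i)) := by
  cases R
  case P0 => obtain ⟨a, h⟩ := h; exact ⟨a, by simp [h, shift]⟩
  case P11 => obtain ⟨a, h⟩ := h; exact ⟨a, by simp [h, shift]⟩
  case P12 => obtain ⟨a, h⟩ := h; exact ⟨a, by simp [h, shift]⟩
  case P2 => obtain ⟨a, b, c, h⟩ := h; exact ⟨a, b, c, by simp [h, shift]⟩
  case P2s => obtain ⟨a, b, h⟩ := h; exact ⟨a, b, by simp [h, shift]⟩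
  case P3 => obtain ⟨a, b, c, h⟩ := h; exact ⟨a, b, c, by simp [h, shift]⟩
  case P3s => obtain ⟨a, b, h⟩ := h; exact ⟨a, b, by simp [h, shift]⟩
  case P4 => obtain ⟨a, h⟩ := h; exact ⟨a, by simp [h, shift]⟩
  case P5 => obtain ⟨a, g, h⟩ := h; exact ⟨a, g + r a, by simp [h, shift]⟩
  case proj l =>
    rcases h with ⟨u, j, hl, h₀, h₁⟩ | ⟨u, h₀, h₁⟩
    · exact Or.inl ⟨u, j, hl, by simp [h₀, shift], by simp [h₁, shift]⟩
    · exact Or.inr ⟨u, by simp [h₀, shift], by simp [h₁, shift]⟩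
  case F2 =>
    obtain ⟨a, b, c, h₀, h₁⟩ := h
    exact ⟨a, b, c, by simp [h₀, shift], by simp [h₁, shift]⟩
  case F3 =>
    obtain ⟨a, b, c, h₀, h₁⟩ := h
    exact ⟨a, b, c, by simp [h₀, shift], by simp [h₁, shift]⟩
  case F4 =>
    obtain ⟨a, b, c, d, h₀, h₁, h₂⟩ := h
    exact ⟨a, b, c, d, by simp [h₀, shift], by simp [h₁, shift], by simp [h₂, shift]⟩
  case F5 =>
    obtain ⟨a, g, h₀, h₁⟩ := h
    exact ⟨a, g + r a, by simp [h₀, shift], by simp [h₁, shift]⟩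
  case F3g =>
    obtain ⟨a, g, h₀, h₁⟩ := h
    exact ⟨a, g + r a, by simp [h₀, shift], by simp [h₁, shift, add_assoc]⟩
  case Q s =>
    obtain ⟨a, i, h, g, ha, rfl, hsum⟩ := h
    refine ⟨a, i, h, g + r a, ha, ?_, ?_⟩
    · rw [append_shift, append_shift, append_shift]
      congr 1
      funext j
      fin_cases j <;> rfl
    · rw [hsum, hr a s hR, AddSubgroup.coe_add, Pi.add_apply]
      ring

theorem interp_shift_iff {A : Finset (Finset Λ)} {f f' : (Fin (k + 1) → I) → Finset Λ → ZMod 2}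
    {r : (Fin (k + 1) → I) → G Λ}
    (hr : ∀ a, ∀ s ∈ A, f a s = (r a : Finset Λ → ZMod 2) s + f' a s)
    {n : ℕ} {R : Sym Λ k n} (hR : InReduct A R) (v : Fin n → Carrier Λ k I) :
    interp f' R (fun i => shift r (v i)) ↔ interp f R v := by
  refine ⟨fun h => ?_, interp_shift hr hR⟩
  have hr' : ∀ a, ∀ s ∈ A, f' a s = (r a : Finset Λ → ZMod 2) s + f a s := fun a s hs => by
    rw [hr a s hs, ← add_assoc, CharTwo.add_self_eq_zero, zero_add]
  simpa only [shift_shift] using interp_shift hr' hR h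

theorem realize_var_term {α : Type} {n : ℕ} (t : (tau Λ k).Term (α ⊕ Fin n))
    {f f' : (Fin (k + 1) → I) → Finset Λ → ZMod 2} (e : Carrier Λ k I → Carrier Λ k I)
    (v : α → Carrier Λ k I) (xs : Fin n → Carrier Λ k I) :
    (t.realize (M := Model Λ k I f') (Sum.elim (e ∘ v) (e ∘ xs)) : Carrier Λ k I) =
      e (t.realize (M := Model Λ k I f) (Sum.elim v xs)) := by
  cases t with
  | var i => cases i <;> rfl
  | func F _ => exact PEmpty.elim F

/-- A formula involves finitely many of the `Q s`, hence is preserved by a suitable `shift`. -/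
theorem exists_realize_shift_iff {α : Type} {n : ℕ} (φ : (tau Λ k).BoundedFormula α n) :
    ∃ A : Finset (Finset Λ), ∀ (I : Type u) (f f' : (Fin (k + 1) → I) → Finset Λ → ZMod 2)
      (r : (Fin (k + 1) → I) → G Λ),
      (∀ a, ∀ s ∈ A, f a s = (r a : Finset Λ → ZMod 2) s + f' a s) →
      ∀ (v : α → Carrier Λ k I) (xs : Fin n → Carrier Λ k I),
        φ.Realize (M := Model Λ k I f') (shift r ∘ v) (shift r ∘ xs) ↔
          φ.Realize (M := Model Λ k I f) v xs := by
  classical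
  induction φ with
  | falsum => exact ⟨∅, fun _ _ _ _ _ _ _ => Iff.rfl⟩
  | equal t₁ t₂ =>
    refine ⟨∅, fun I f f' r _ v xs => ?_⟩
    simp only [FirstOrder.Language.BoundedFormula.Realize]
    have h₁ := realize_var_term t₁ (f := f) (f' := f') (shift r) v xs
    have h₂ := realize_var_term t₂ (f := f) (f' := f') (shift r) v xs
    exact (Eq.congr h₁ h₂).trans (shiftEquiv r).injective.eq_iff
  | rel R ts =>
    obtain ⟨A, hA⟩ := exists_inReduct (k := k) R
    refine ⟨A, fun I f f' r hr v xs => ?_⟩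
    refine Iff.trans (iff_of_eq ?_) (interp_shift_iff hr hA _)
    refine congrArg (interp f' R) (funext fun i => ?_)
    exact realize_var_term (ts i) (shift r) v xs
  | imp φ θ ih₁ ih₂ =>
    obtain ⟨A, hA⟩ := ih₁
    obtain ⟨B, hB⟩ := ih₂
    exact ⟨A ∪ B, fun I f f' r hr v xs => imp_congr
      (hA I f f' r (fun a s hs => hr a s (Finset.mem_union_left _ hs)) v xs)
      (hB I f f' r (fun a s hs => hr a s (Finset.mem_union_right _ hs)) v xs)⟩
  | all φ ih =>
    obtain ⟨A, hA⟩ := ih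
    refine ⟨A, fun I f f' r hr v xs => ?_⟩
    refine Iff.trans ?_ (forall_congr' fun x => hA I f f' r hr v (Fin.snoc xs x))
    -- The shift is a permutation, so the quantifier may range over shifted elements.
    refine (shiftEquiv r).surjective.forall.trans (forall_congr' fun x => ?_)
    exact iff_of_eq (congrArg (φ.Realize (M := Model Λ k I f') (shift r ∘ v))
      (Fin.comp_snoc (shift r) xs x).symm)

-- Some `x` lies in no member of the finite family `A`; every `v` containing `x` is then outside
-- `A`.
open Classical in
theorem setOf_eq_zero_mem_regFilter [Infinite Λ] (A : Finset (Finset Λ)) (p : Finset Λ → ZMod 2) :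
    {s | (if s ∈ A then p s else 0) = 0} ∈ regFilter Λ := by
  obtain ⟨x, hx⟩ := Infinite.exists_notMem_finset (A.biUnion id)
  refine mem_regFilter.2 ⟨{x}, fun v hv => if_neg fun hvA => hx ?_⟩
  exact Finset.mem_biUnion.2 ⟨v, hvA, hv (Finset.mem_singleton_self x)⟩

/-- All the structures `M_{I,f}`, for a given `I`, are elementarily equivalent. -/
theorem realize_sentence_iff [Infinite Λ] (f f' : (Fin (k + 1) → I) → Finset Λ → ZMod 2)
    (σ : (tau Λ k).Sentence) : Model Λ k I f ⊨ σ ↔ Model Λ k I f' ⊨ σ := by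
  classical
  obtain ⟨A, hA⟩ := exists_realize_shift_iff σ
  -- Cutting off outside `A` is what puts the difference into `G`.
  let r : (Fin (k + 1) → I) → G Λ := fun a =>
    ⟨fun s => if s ∈ A then f a s - f' a s else 0, setOf_eq_zero_mem_regFilter A _⟩
  have hr : ∀ a, ∀ s ∈ A, f a s = (r a : Finset Λ → ZMod 2) s + f' a s := fun a s hs => by
    simp [r, hs]
  exact (hA I f f' r hr default default).symm.trans <| iff_of_eq <|
    congrArg₂ (FirstOrder.Language.BoundedFormula.Realize (M := Model Λ k I f') σ)
      (Subsingleton.elim _ _) (Subsingleton.elim _ _)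

theorem holds_psi [Infinite Λ] [Infinite I] (f : (Fin (k + 1) → I) → Finset Λ → ZMod 2) :
    (psi Λ k).Holds (Model Λ k I f) := by
  refine ⟨fun σ => ?_, ?_, ?_, ?_⟩
  · refine (InfFormula.realize_ofFirstOrder _ _).2 ?_
    refine (iff_of_eq ?_).1 ((realize_sentence_iff f _ σ.1).2 (σ.2 I inferInstance))
    exact congrArg₂ (FirstOrder.Language.BoundedFormula.Realize (M := Model Λ k I f) σ.1)
      (Subsingleton.elim _ _) (Subsingleton.elim _ _)
  · rintro x y ⟨⟨a, g, hx⟩, ⟨a', g', hy⟩, z, ⟨b, g₁, hb, hz⟩, ⟨b', g₁', hb', hz'⟩⟩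
    refine ⟨g' - g, a, g, hx, ?_⟩
    change x = _ at hx
    change y = _ at hy
    change x = _ at hb
    change z = _ at hz
    change y = _ at hb'
    change z = _ at hz'
    change y = _
    subst hx hy hz
    cases hb; cases hb'; cases hz'
    rw [sub_add_cancel]
  · exact fun y => ⟨fun ⟨u, s, h, e⟩ => ⟨s, u, h, e⟩, fun ⟨s, u, h, e⟩ => ⟨u, s, h, e⟩⟩
  · exact fun y => ⟨fun ⟨u, s, h, e⟩ => ⟨s, u, h, e⟩, fun ⟨s, u, h, e⟩ => ⟨u, s, h, e⟩⟩

end ElementaryEquivalence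

/-! ### Cardinality of the universe. -/

section CardinalArithmetic

theorem le_bethIter_succ (κ : Cardinal.{u}) (n : ℕ) : 2 ^ κ ≤ bethIter κ (n + 1) := by
  induction n with
  | zero => exact le_rfl
  | succ n ih => exact ih.trans (Cardinal.cantor _).le

theorem mk_tuples_le {I : Type u} [Infinite I] (n : ℕ) : #(Fin n → I) ≤ #I := by
  simpa using Cardinal.power_nat_le (n := n) (Cardinal.aleph0_le_mk I)

theorem mk_carrier {Λ : Type u} [Infinite Λ] (k : ℕ) {I : Type u} (hk : k ≠ 0) (hI : 2 ^ #Λ ≤ #I) :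
    #(Carrier Λ k I) = #I := by
  have hΛ : #Λ ≤ #I := (Cardinal.cantor _).le.trans hI
  have h₀ : ℵ₀ ≤ #I := (Cardinal.aleph0_le_mk Λ).trans hΛ
  have : Infinite I := Cardinal.infinite_iff.2 h₀
  -- With `k ≠ 0` the set `^kI` is infinite, as the cardinality formula for `H k I` requires.
  have : Nonempty (Fin k) := ⟨⟨0, Nat.pos_of_ne_zero hk⟩⟩
  refine le_antisymm ?_ (Cardinal.mk_le_of_injective (f := Carrier.pt) fun a b h => by cases h; rfl)
  have hS : #(Finset Λ) ≤ #I := by rwa [Cardinal.mk_finset_of_infinite]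
  have hG : #(G Λ) ≤ #I := (mk_G_le Λ).trans hI
  have hH : #(H k I) ≤ #I := by
    rw [Cardinal.mk_finsupp_lift_of_infinite]
    refine max_le (by simpa using mk_tuples_le k) (le_trans ?_ h₀)
    simp
  have hZ : #(ULift.{u} (ZMod 2)) ≤ #I := le_trans (by simp) h₀
  let F : I ⊕ (Fin k → I) ⊕ (Fin (k + 1) → I) ⊕ ((Fin k → I) × Finset Λ × H k I) ⊕
      ((Fin k → I) × Finset Λ × ULift.{u} (ZMod 2)) ⊕ H k I ⊕ ((Fin (k + 1) → I) × G Λ) →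
      Carrier Λ k I :=
    Sum.elim pt <| Sum.elim tup <| Sum.elim tup' <| Sum.elim (fun x => hCopy x.1 x.2.1 x.2.2) <|
      Sum.elim (fun x => zCopy x.1 x.2.1 x.2.2.down) <| Sum.elim hElt fun x => gCopy x.1 x.2
  have hF : Function.Surjective F := by
    rintro (a | u | u | ⟨u, s, h⟩ | ⟨u, s, i⟩ | h | ⟨u, g⟩)
    · exact ⟨.inl a, rfl⟩
    · exact ⟨.inr (.inl u), rfl⟩
    · exact ⟨.inr (.inr (.inl u)), rfl⟩
    · exact ⟨.inr (.inr (.inr (.inl (u, s, h)))), rfl⟩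
    · exact ⟨.inr (.inr (.inr (.inr (.inl (u, s, ⟨i⟩))))), rfl⟩
    · exact ⟨.inr (.inr (.inr (.inr (.inr (.inl h))))), rfl⟩
    · exact ⟨.inr (.inr (.inr (.inr (.inr (.inr (u, g)))))), rfl⟩
  have hsum : ∀ {α β : Type u}, #α ≤ #I → #β ≤ #I → #(α ⊕ β) ≤ #I := fun ha hb => by
    rw [← Cardinal.add_def]; exact Cardinal.add_le_of_le h₀ ha hb
  have hprod : ∀ {α β : Type u}, #α ≤ #I → #β ≤ #I → #(α × β) ≤ #I := fun ha hb => by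
    rw [← Cardinal.mul_def]; exact Cardinal.mul_le_of_le h₀ ha hb
  refine (Cardinal.mk_le_of_surjective hF).trans ?_
  exact hsum le_rfl <| hsum (mk_tuples_le k) <| hsum (mk_tuples_le _) <|
    hsum (hprod (mk_tuples_le k) (hprod hS hH)) <| hsum (hprod (mk_tuples_le k) (hprod hS hZ)) <|
    hsum hH (hprod (mk_tuples_le _) hG)

end CardinalArithmetic

/-! ### Non-isomorphism: cancellation of faces and the functional equation. -/

/-- The square of the simplicial boundary vanishes modulo 2. -/
theorem sum_sum_omit_omit {I : Type u} {m : ℕ} (b : Fin (m + 2) → I) (F : (Fin m → I) → ZMod 2) :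
    ∑ j : Fin (m + 2), ∑ l : Fin (m + 1), F (omit_ (omit_ b j) l) = 0 := by
  rw [← Fintype.sum_prod_type']
  -- The involution exchanges the order in which two given entries are deleted.
  refine Finset.sum_involution (fun x _ => (x.1.succAbove x.2, x.2.predAbove x.1)) ?_ ?_ ?_ ?_
  · rintro ⟨j, l⟩ -
    have h : omit_ (omit_ b (j.succAbove l)) (l.predAbove j) = omit_ (omit_ b j) l :=
      funext fun i => congrArg b (Fin.succAbove_succAbove_succAbove_predAbove j l i)
    rw [h]
    exact CharTwo.add_self_eq_zero _
  · rintro ⟨j, l⟩ - - h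
    exact Fin.succAbove_ne j l (congrArg Prod.fst h)
  · exact fun _ _ => Finset.mem_univ _
  · rintro ⟨j, l⟩ -
    exact Prod.ext (Fin.succAbove_succAbove_predAbove j l) (Fin.predAbove_predAbove_succAbove j l)

section NonIsomorphism

variable {Λ : Type u} {k : ℕ} {I : Type u}

/-- The point underlying an element of the sort `P_0`. -/
noncomputable def ptVal [Nonempty I] : Carrier Λ k I → I
  | pt a => a
  | _ => Classical.arbitrary I

/-- The `ℤ/2`-coordinate of an element of the sort `P_3`. -/
def zVal : Carrier Λ k I → ZMod 2
  | zCopy _ _ i => i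
  | _ => 0

/-- The `H`-coordinate of an element of the sort `P_2`. -/
def hVal : Carrier Λ k I → H k I
  | hCopy _ _ h => h
  | _ => 0

/-- The `G`-coordinate of an element of the sort `P_5`. -/
def gVal : Carrier Λ k I → G Λ
  | gCopy _ g => g
  | _ => 0

theorem map_interp {f f' : (Fin (k + 1) → I) → Finset Λ → ZMod 2}
    (Φ : Model Λ k I f ≃[tau Λ k] Model Λ k I f') {n : ℕ} (R : Sym Λ k n)
    {v : Fin n → Carrier Λ k I} (h : interp f R v) : interp f' R (fun i => Φ (v i)) :=
  (Φ.map_rel (R : (tau Λ k).Relations n) v).2 h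

/-- An isomorphism acts on each fibre of `P_{3,s}` as a translation. -/
theorem zVal_map {f f' : (Fin (k + 1) → I) → Finset Λ → ZMod 2}
    (Φ : Model Λ k I f ≃[tau Λ k] Model Λ k I f') (u : Fin k → I) (s : Finset Λ) (i : ZMod 2) :
    zVal (Φ (zCopy u s i)) = i + zVal (Φ (zCopy u s 0)) := by
  -- Preservation of `F3` and `P3s` sends the whole fibre over `(u, s)` into one fibre; an injection
  -- between two-element fibres is a translation. The fallback branch of the `match` never occurs.
  have key : ∀ i : ZMod 2, ∃ j, Φ (zCopy u s i) = zCopy (Λ := Λ)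
      (match Φ (tup u) with | tup w => w | _ => u) s j := by
    intro i
    obtain ⟨u₁, i₁, h₁⟩ := map_interp Φ (.P3s s) (v := ![zCopy u s i]) ⟨u, i, rfl⟩
    obtain ⟨u₂, s₂, i₂, h₂, h₃⟩ := map_interp Φ .F3 (v := ![zCopy u s i, tup u]) ⟨u, s, i, rfl, rfl⟩
    change Φ (zCopy u s i) = _ at h₁
    change Φ (zCopy u s i) = _ at h₂
    change Φ (tup u) = _ at h₃
    rw [h₁] at h₂
    cases h₂
    rw [h₃]
    exact ⟨i₁, h₁⟩
  obtain ⟨j₀, h₀⟩ := key 0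
  obtain ⟨j₁, h₁⟩ := key 1
  have hne : j₁ ≠ j₀ := by
    rintro rfl
    have h := Φ.injective (h₁.trans h₀.symm)
    injection h with _ _ h
    exact one_ne_zero h
  have hj : j₁ = 1 + j₀ := by
    have two : ∀ x y : ZMod 2, x ≠ y → x = 1 + y := by decide
    exact two j₁ j₀ hne
  have hi : i = 0 ∨ i = 1 := by
    revert i
    decide
  rcases hi with rfl | rfl
  · rw [zero_add]
  · rw [h₀, h₁]
    exact hj

theorem exists_sum_eq (hk : k ≠ 0) (x : ZMod 2) : ∃ i : Fin k → ZMod 2, ∑ l, i l = x :=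
  ⟨Pi.single ⟨0, Nat.pos_of_ne_zero hk⟩ x, by simp⟩

/-- The functional equation satisfied by `f` when `M_{I,f}` is isomorphic to `M_I`. -/
theorem exists_functional_equation (hk : k ≠ 0) [Nonempty I]
    {f : (Fin (k + 1) → I) → Finset Λ → ZMod 2}
    (Φ : Model Λ k I f ≃[tau Λ k] Model₀ Λ k I) :
    ∃ (p : I → I) (c : (Fin k → I) → Finset Λ → ZMod 2) (d : (Fin k → I) → Finset Λ → H k I)
      (e : (Fin (k + 1) → I) → G Λ), Function.Injective p ∧
      ∀ a, Function.Injective a → ∀ s, f a s + ∑ l : Fin k, c (omit_ a l.castSucc) s =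
        d (omit_ a (Fin.last k)) s (omit_ (fun m => p (a m)) 0) +
          (e a : Finset Λ → ZMod 2) s := by
  have hp : ∀ a, Φ (pt a) = pt (Λ := Λ) (k := k) (ptVal (Φ (pt a))) := fun a => by
    obtain ⟨a', h⟩ := map_interp Φ .P0 (v := ![pt a]) ⟨a, rfl⟩
    change Φ (pt a) = _ at h
    rw [h]
    rfl
  refine ⟨fun a => ptVal (Φ (pt a)), fun u s => zVal (Φ (zCopy u s 0)),
    fun u s => hVal (Φ (hCopy u s 0)), fun a => gVal (Φ (gCopy a 0)), ?_, ?_⟩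
  · intro a b hab
    have h := Φ.injective ((hp a).trans ((congrArg pt hab).trans (hp b).symm))
    injection h
  intro a ha s
  -- With `h = 0` and `g = 0`, these `i` put the tuple in `Q s`. The equation is the defining
  -- equation of the image tuple, where the function is `0`.
  obtain ⟨i, hi⟩ := exists_sum_eq hk (f a s)
  obtain ⟨a', i', h', g', -, hv, hsum⟩ := map_interp Φ (.Q s)
    (v := Fin.append (Fin.append (Fin.append (fun l => pt (a l)) (fun l => tup (omit_ a l)))
      (fun l : Fin k => zCopy (omit_ a l.castSucc) s (i l)))
      ![hCopy (omit_ a (Fin.last k)) s 0, gCopy a 0]) ⟨a, i, 0, 0, ha, rfl, by simpa using hi⟩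
  have h₁ : ∀ l, Φ (pt (a l)) = pt (Λ := Λ) (k := k) (a' l) := fun l => by
    simpa using congrFun hv (Fin.castAdd _ (Fin.castAdd _ (Fin.castAdd _ l)))
  have h₂ : ∀ l : Fin k, Φ (zCopy (omit_ a l.castSucc) s (i l)) =
      zCopy (omit_ a' l.castSucc) s (i' l) := fun l => by
    simpa using congrFun hv (Fin.castAdd _ (Fin.natAdd _ l))
  have h₃ : Φ (hCopy (omit_ a (Fin.last k)) s 0) = hCopy (omit_ a' (Fin.last k)) s h' := by
    have h := congrFun hv (Fin.natAdd _ 0)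
    simp only [Fin.append_right] at h
    exact h
  have h₄ : Φ (gCopy a 0) = gCopy a' g' := by
    have h := congrFun hv (Fin.natAdd _ 1)
    simp only [Fin.append_right] at h
    exact h
  have ha' : (fun m => ptVal (Φ (pt (a m)))) = a' := funext fun l => by rw [h₁]; rfl
  have hi' : ∀ l, i' l = i l + zVal (Φ (zCopy (omit_ a l.castSucc) s 0)) := fun l => by
    rw [← zVal_map Φ, h₂]
    rfl
  have hd : hVal (Φ (hCopy (omit_ a (Fin.last k)) s 0)) = h' := congrArg hVal h₃
  have he : gVal (Φ (gCopy a 0)) = g' := congrArg gVal h₄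
  rw [← hi, ← Finset.sum_add_distrib, ha']
  refine (Finset.sum_congr rfl fun l _ => (hi' l).symm).trans (hsum.trans ?_)
  exact (add_zero _).trans (congrArg₂ (fun (h : H k I) (g : G Λ) => h (omit_ a' 0) +
    (g : Finset Λ → ZMod 2) s) hd.symm he.symm)

/-! ### The function `f` and the contradiction. -/

open Classical in
/-- The function equal to the constant `1` at the sets omitting `b₀`, and to the indicator
of `∅ ∈ S` at the sets containing `b₀`. -/
noncomputable def pointedFun (Λ : Type u) (k : ℕ) (b₀ : I) :
    {w : Finset I // w.card = k + 1} → Finset Λ → ZMod 2 :=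
  fun w s => if b₀ ∈ w.1 ∧ s ≠ ∅ then 0 else 1

/-- The value `1` at `∅` makes every `f_w` nonzero, while the filter ignores this single point. -/
theorem pointedFun_isIFunction (b₀ : I) : IsIFunction (pointedFun Λ k b₀) := fun w =>
  Filter.Eventually.of_forall fun _ h => by
    simpa [pointedFun] using congrFun h ∅

open Classical in
theorem onTuples_pointedFun (b₀ : I) {a : Fin (k + 1) → I} (ha : Function.Injective a)
    {s : Finset Λ} (hs : s ≠ ∅) :
    onTuples (pointedFun Λ k b₀) a s = if ∃ l, a l = b₀ then 0 else 1 := by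
  simp [onTuples, ha, pointedFun, hs]

/-- Outside a set of at most `λ` values of the last coordinate, the finitely supported term of
the functional equation vanishes. -/
theorem exists_notMem_support [Infinite Λ] (hk : k ≠ 0) (hI : #Λ < #I) {p : I → I}
    (hp : Function.Injective p) (d : (Fin k → I) → Finset Λ → H k I) (b : Fin (k + 1) → I) :
    ∃ z, (∀ j, b j ≠ z) ∧ ∀ (j : Fin (k + 1)) (s : Finset Λ), d (omit_ b j) s
      (omit_ (fun m => p ((Fin.snoc (omit_ b j) z : Fin (k + 1) → I) m)) 0) = 0 := by
  obtain ⟨m, rfl⟩ := Nat.exists_eq_succ_of_ne_zero hk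
  -- There are `λ` such sets; finiteness of each leaves at most `λ` excluded points.
  let B : Fin (m + 2) × Finset Λ → Set I := fun x => {z | b x.1 = z} ∪ {z | d (omit_ b x.1) x.2
      (omit_ (fun i => p ((Fin.snoc (omit_ b x.1) z : Fin (m + 2) → I) i)) 0) ≠ 0}
  have hB : ∀ x, (B x).Finite := fun x => by
    refine (Set.finite_singleton (b x.1)).subset (fun z hz => hz.symm) |>.union ?_
    -- Omitting coordinate `0` keeps the last coordinate `p z`, so the tuple determines `z` and the
    -- finite support pulls back to a finite set.
    refine Set.Finite.preimage (f := fun z =>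
      omit_ (fun i => p ((Fin.snoc (omit_ b x.1) z : Fin (m + 2) → I) i)) 0) (fun z _ z' _ h => ?_)
      (d (omit_ b x.1) x.2).hasFiniteSupport
    have h := congrFun h (Fin.last m)
    simp only [omit_, Fin.succAbove_zero, Fin.succ_last, Fin.snoc_last] at h
    exact hp h
  have hlt : #(⋃ x, B x) < #I := by
    refine lt_of_le_of_lt ?_ hI
    refine (Cardinal.mk_iUnion_le B).trans (Cardinal.mul_le_of_le (Cardinal.aleph0_le_mk Λ) ?_ ?_)
    · simp only [Cardinal.mk_prod, Cardinal.lift_uzero,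
        Cardinal.mk_finset_of_infinite]
      refine Cardinal.mul_le_of_le (Cardinal.aleph0_le_mk Λ)
        (le_trans ?_ (Cardinal.aleph0_le_mk Λ)) le_rfl
      simp
    · exact ciSup_le' fun x => (Cardinal.lt_aleph0_iff_set_finite.2 (hB x)).le.trans
        (Cardinal.aleph0_le_mk Λ)
  obtain ⟨z, hz⟩ : ∃ z, z ∉ ⋃ x, B x := by
    by_contra! h
    rw [Set.eq_univ_of_forall h, Cardinal.mk_univ] at hlt
    exact lt_irrefl _ hlt
  simp only [Set.mem_iUnion, not_exists] at hz
  exact ⟨z, fun j h => hz (j, ∅) (Or.inl h), fun j s => by_contra fun h => hz (j, s) (Or.inr h)⟩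

/-- The tuples `a j` are the faces of the simplex `(b, z)` that contain `z`. Exactly one of them, `a
0`, misses `b 0`, so `f` sums to `1` over them. -/
theorem isEmpty_equiv_pointedFun [Infinite Λ] (hk : k ≠ 0) (hI : #Λ < #I) {b : Fin (k + 1) → I}
    (hb : Function.Injective b) :
    IsEmpty (Model Λ k I (onTuples (pointedFun Λ k (b 0))) ≃[tau Λ k] Model₀ Λ k I) := by
  classical
  refine ⟨fun Φ => ?_⟩
  have : Nonempty I := ⟨b 0⟩
  obtain ⟨p, c, d, e, hp, heq⟩ := exists_functional_equation hk Φ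
  obtain ⟨z, hbz, hz⟩ := exists_notMem_support hk hI hp d b
  obtain ⟨m, rfl⟩ := Nat.exists_eq_succ_of_ne_zero hk
  let a : Fin (m + 2) → Fin (m + 2) → I := fun j => Fin.snoc (omit_ b j) z
  have ha : ∀ j, Function.Injective (a j) := fun j =>
    Fin.snoc_injective_iff.2 ⟨hb.comp Fin.succAbove_right_injective, fun ⟨i, hi⟩ => hbz _ hi⟩
  have hlast : ∀ j, omit_ (a j) (Fin.last (m + 1)) = omit_ b j := fun j => funext fun i => by
    simp [omit_, a]
  have hcast : ∀ j (l : Fin (m + 1)), omit_ (a j) l.castSucc =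
      Fin.snoc (omit_ (omit_ b j) l) z := fun j l => funext fun i => by
    refine Fin.lastCases ?_ (fun i => ?_) i
    · simp [omit_, a]
    · simp [omit_, a]
  have hmem : ∀ j, (∃ l, a j l = b 0) ↔ j ≠ 0 := fun j => by
    constructor
    · rintro ⟨l, hl⟩ rfl
      revert hl
      refine Fin.lastCases (fun hl => ?_) (fun i hl => ?_) l
      · exact hbz 0 (by simpa [a] using hl.symm)
      · have := hb (by simpa [a, omit_] using hl : b i.succ = b 0)
        exact Fin.succ_ne_zero i this
    · intro hj
      obtain ⟨i, hi⟩ := Fin.exists_succAbove_eq hj.symm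
      exact ⟨i.castSucc, by simp [a, omit_, hi]⟩
  have hsum : ∀ s : Finset Λ, s ≠ ∅ → (1 : ZMod 2) = ∑ j, (e (a j) : Finset Λ → ZMod 2) s := by
    intro s hs
    have h₁ : ∀ j, (if j ≠ 0 then (0 : ZMod 2) else 1) + ∑ l : Fin (m + 1),
        c (Fin.snoc (omit_ (omit_ b j) l) z) s = (e (a j) : Finset Λ → ZMod 2) s := fun j => by
      have h := heq (a j) (ha j) s
      rw [hlast, hz j s, zero_add, onTuples_pointedFun _ (ha j) hs] at h
      simpa only [hcast, hmem] using h
    -- After summation over `j`, the `c`-terms form a double boundary of `b`, with `z` appended to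
    -- every face.
    have h₂ := Finset.sum_congr (rfl : (Finset.univ : Finset (Fin (m + 2))) = _) fun j _ => h₁ j
    rw [Finset.sum_add_distrib, sum_sum_omit_omit b fun v => c (Fin.snoc v z) s] at h₂
    simpa using h₂
  -- There are only finitely many `j`, so one large `s` annihilates all the `e (a j)`.
  have hev : ∀ᶠ s in regFilter Λ, ∀ j, (e (a j) : Finset Λ → ZMod 2) s = 0 :=
    Filter.eventually_all.2 fun j => (e (a j)).2
  obtain ⟨x⟩ : Nonempty Λ := inferInstance
  have hne : ∀ᶠ s in regFilter Λ, s ≠ ∅ :=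
    mem_regFilter.2 ⟨{x}, fun v hv => Finset.ne_empty_of_mem (hv (Finset.mem_singleton_self x))⟩
  have : (regFilter Λ).NeBot := inferInstanceAs (Filter.atTop : Filter (Finset Λ)).NeBot
  obtain ⟨s, hs₀, hs⟩ := (hev.and hne).exists
  have h := hsum s hs
  rw [Finset.sum_eq_zero fun j _ => hs₀ j] at h
  exact one_ne_zero h

end NonIsomorphism

end Canonical

/-! ### The main theorem. -/

theorem mainTheorem2 (Λ : Type u) [Infinite Λ] (k : ℕ) (hk : 2 ≤ k) (μ : Cardinal.{u})
    (hμ : μ = Order.succ (bethIter #Λ (k + 1))) :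
    ¬ InfSentence.Categorical (Canonical.psi Λ k) μ ∧
    ∀ I : Type u, #I = μ →
      ∃ f : {w : Finset I // w.card = k + 1} → Finset Λ → ZMod 2,
        Canonical.IsIFunction f ∧
        #(Canonical.Model₀ Λ k I) = μ ∧
        #(Canonical.Model Λ k I (Canonical.onTuples f)) = μ ∧
        InfSentence.Holds (Canonical.psi Λ k) (Canonical.Model₀ Λ k I) ∧
        InfSentence.Holds (Canonical.psi Λ k)
          (Canonical.Model Λ k I (Canonical.onTuples f)) ∧
        IsEmpty (Canonical.Model Λ k I (Canonical.onTuples f) ≃[Canonical.tau Λ k]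
          Canonical.Model₀ Λ k I) := by
  have hk₀ : k ≠ 0 := by omega
  -- This bounds `|G|` in the cardinality count and gives `λ < |I|` for the choice of `z`.
  have hle : 2 ^ #Λ ≤ μ := hμ ▸ (Canonical.le_bethIter_succ #Λ k).trans (Order.le_succ _)
  have main : ∀ I : Type u, #I = μ →
      ∃ f : {w : Finset I // w.card = k + 1} → Finset Λ → ZMod 2,
        Canonical.IsIFunction f ∧
        #(Canonical.Model₀ Λ k I) = μ ∧
        #(Canonical.Model Λ k I (Canonical.onTuples f)) = μ ∧
        InfSentence.Holds (Canonical.psi Λ k) (Canonical.Model₀ Λ k I) ∧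
        InfSentence.Holds (Canonical.psi Λ k)
          (Canonical.Model Λ k I (Canonical.onTuples f)) ∧
        IsEmpty (Canonical.Model Λ k I (Canonical.onTuples f) ≃[Canonical.tau Λ k]
          Canonical.Model₀ Λ k I) := by
    rintro I rfl
    have hlt : #Λ < #I := (Cardinal.cantor _).trans_le hle
    have : Infinite I :=
      Cardinal.infinite_iff.2 ((Cardinal.aleph0_le_mk Λ).trans hlt.le)
    let b : Fin (k + 1) ↪ I := Fin.valEmbedding.trans (Infinite.natEmbedding I)
    exact ⟨Canonical.pointedFun Λ k (b 0), Canonical.pointedFun_isIFunction _,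
      Canonical.mk_carrier k hk₀ hle, Canonical.mk_carrier k hk₀ hle, Canonical.holds_psi _,
      Canonical.holds_psi _, Canonical.isEmpty_equiv_pointedFun hk₀ hlt b.injective⟩
  refine ⟨fun hcat => ?_, main⟩
  obtain ⟨f, -, hc₀, hcf, h₀, hf, hiso⟩ := main μ.out (Cardinal.mk_out μ)
  exact hiso.false (hcat _ _ hcf hc₀ hf h₀).some
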